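/- Let $p\ge 5$ be a prime and let $r\ge 1$ be an integer. For a field $K$ and parameters $a_i,b_j,z\in K$ put $$ {}_{u}F_{v}\left[\begin{matrix}a_1,\dots,a_u\\ b_1,\dots,b_v\end{matrix};z\right]_n=\sum_{k=0}^{n-1}\frac{(a_1)_k\cdots(a_u)_k}{(b_1)_k\cdots(b_v)_k}\cdot\frac{z^k}{k!},\qquad (a)_0=1,\quad (a)_k=a(a+1)\cdots(a+k-1)\ (k\ge 1).$$ For $x\in\mathbb{Z}_p$ let $\Gamma_p(x)=\lim_{m\to x}(-1)^m\prod_{1<k<m,\ (k,p)=1}k$ be the $p$-adic Gamma function, the limit being taken over non-negative integers $m$ tending $p$-adically to $x$, and let $\langle x\rangle_p$ be the least non-negative integer $s$ with $x\equiv s\pmod p$. For $x,y\in\mathbb{Q}_p$, $x\equiv y\pmod{p^N}$ means $x-y\in p^N\mathbb{Z}_p$. Let $a\in\left\{-\tfrac12,-\tfrac13,-\tfrac14,-\tfrac16\right\}$ be such that $\langle a\rangle_p$ is even. Then $$ {}_3F_2\left[\begin{matrix}\tfrac12,\,-a,\,a+1\\ 1,\,1\end{matrix};1\right]_{p^r}\equiv(-1)^{\frac{r(p+1)}{2}}\,\Gamma_p\left(-\frac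 a2\right)^{2r}\Gamma_p\left(\frac{a+1}2\right)^{2r}\pmod{p^2}.$$ -/

import Mathlib

open Filter Topology

/-- The truncated hypergeometric series
`∑_{k=0}^{n-1} (a₁)_k ⋯ (a_r)_k / ((b₁)_k ⋯ (b_s)_k) · z^k / k!`,
where `(a)_k = a (a+1) ⋯ (a+k-1)` is the rising factorial; `us` is the list of upper parameters
and `ls` the list of lower parameters. -/
noncomputable def truncHypergeometric {K : Type*} [Field K] (us ls : List K) (z : K) (n : ℕ) : K :=
  ∑ k ∈ Finset.range n,
    (us.map fun a => (ascPochhammer K k).eval a).prod /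
      (ls.map fun b => (ascPochhammer K k).eval b).prod * (z ^ k / (k.factorial : K))

/-- The congruence `x ≡ y (mod p^N)` of `p`-adic numbers: `x - y ∈ p^N ℤ_p`. -/
def PadicModEq (p : ℕ) [Fact p.Prime] (N : ℕ) (x y : ℚ_[p]) : Prop :=
  ∃ z : ℤ_[p], x - y = (p : ℚ_[p]) ^ N * (z : ℚ_[p])

/-- `⟨a⟩_p`: the least non-negative integer `r` with `a ≡ r (mod p)`, for a `p`-adic integer `a`. -/
noncomputable def leastResidue (p : ℕ) [Fact p.Prime] (a : ℚ_[p]) : ℕ :=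
  sInf {r : ℕ | PadicModEq p 1 a (r : ℚ_[p])}

/-- `(-1)^m ∏ k`, the product over all `1 < k < m` with `k` coprime to `p`. -/
def padicGammaNat (p m : ℕ) : ℤ :=
  (-1) ^ m * ∏ k ∈ (Finset.range m).filter (fun k => 1 < k ∧ Nat.Coprime k p), (k : ℤ)

/-- Morita's `p`-adic Gamma function: the limit of `(-1)^m ∏_{1 < k < m, (k, p) = 1} k` as the
non-negative integer `m` tends `p`-adically to the `p`-adic integer `x`. The limit exists for every
`p`-adic integer `x` when `p` is odd, see `tendsto_padicGamma` (outside `ℤ_p` the value is junk). -/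
noncomputable def padicGamma (p : ℕ) [Fact p.Prime] (x : ℚ_[p]) : ℚ_[p] :=
  limUnder (comap (fun m : ℕ => (m : ℚ_[p])) (𝓝 x)) (fun m : ℕ => (padicGammaNat p m : ℚ_[p]))

theorem zmod_prod_units_prime_pow {p N : ℕ} [Fact p.Prime] (hp2 : p ≠ 2) :
    ∏ u : (ZMod (p ^ N))ˣ, u = -1 := by
  classical
  have hp : p.Prime := Fact.out
  have hsq : ∀ u : (ZMod (p ^ N))ˣ, u⁻¹ = u → u = 1 ∨ u = -1 := by
    intro u hu
    have h1 : (u : ZMod (p ^ N)) * u = 1 := by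
      have : u * u = 1 := by
        nth_rewrite 1 [← hu]
        exact inv_mul_cancel u
      simpa using congrArg Units.val this
    obtain ⟨x, hx⟩ := ZMod.intCast_surjective (u : ZMod (p ^ N))
    have h2 : ((p : ℤ) ^ N) ∣ (x - 1) * (x + 1) := by
      have : (((x - 1) * (x + 1) : ℤ) : ZMod (p ^ N)) = 0 := by
        push_cast
        rw [hx]
        linear_combination h1
      have h3 := (ZMod.intCast_zmod_eq_zero_iff_dvd _ _).1 this
      exact_mod_cast h3
    have hpp : Prime (p : ℤ) := Nat.prime_iff_prime_int.1 hp
    have key : ((p : ℤ) ^ N) ∣ (x - 1) ∨ ((p : ℤ) ^ N) ∣ (x + 1) := by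
      by_cases hd : (p : ℤ) ∣ (x - 1)
      · left
        apply hpp.pow_dvd_of_dvd_mul_right N _ h2
        intro hd'
        have : (p : ℤ) ∣ 2 := by
          have := dvd_sub hd' hd
          ring_nf at this
          exact this
        have h4 : p ∣ 2 := by exact_mod_cast this
        exact hp2 ((Nat.prime_dvd_prime_iff_eq hp Nat.prime_two).1 h4)
      · right
        exact hpp.pow_dvd_of_dvd_mul_left N hd h2
    rcases key with h | h
    · left
      have : ((x - 1 : ℤ) : ZMod (p ^ N)) = 0 :=
        (ZMod.intCast_zmod_eq_zero_iff_dvd _ _).2 (by exact_mod_cast h)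
      push_cast at this
      rw [hx] at this
      exact Units.ext (by simpa using sub_eq_zero.1 this)
    · right
      have : ((x + 1 : ℤ) : ZMod (p ^ N)) = 0 :=
        (ZMod.intCast_zmod_eq_zero_iff_dvd _ _).2 (by exact_mod_cast h)
      push_cast at this
      rw [hx] at this
      exact Units.ext (by simpa using eq_neg_of_add_eq_zero_left this)
  rw [← Finset.mul_prod_erase Finset.univ (fun u : (ZMod (p ^ N))ˣ => u) (Finset.mem_univ (-1))]
  have : ∏ u ∈ Finset.univ.erase (-1 : (ZMod (p ^ N))ˣ), u = 1 := by
    refine Finset.prod_involution (fun u _ => u⁻¹) ?_ ?_ ?_ ?_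
    · intro u _
      exact mul_inv_cancel u
    · intro u hu hu1 h
      rcases hsq u h with h | h
      · exact hu1 h
      · exact (Finset.mem_erase.1 hu).1 h
    · intro u hu
      refine Finset.mem_erase.2 ⟨fun h => (Finset.mem_erase.1 hu).1 ?_, Finset.mem_univ _⟩
      rw [← inv_inv u, h]
      simp
    · intro u _
      exact inv_inv u
  rw [this, mul_one]

theorem padicGammaNat_add_pow {p N : ℕ} [Fact p.Prime] (hp2 : p ≠ 2) (hN : N ≠ 0) (m : ℕ) :
    ((padicGammaNat p (m + p ^ N) : ℤ) : ZMod (p ^ N)) = (padicGammaNat p m : ℤ) := by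
  classical
  have hp : p.Prime := Fact.out
  have hodd : Odd (p ^ N) := (hp.odd_of_ne_two hp2).pow
  have : NeZero (p ^ N) := ⟨pow_ne_zero _ hp.ne_zero⟩
  let φ : ZMod (p ^ N) → ZMod (p ^ N) := fun x => -(if IsUnit x then x else 1)
  have hg : ∀ n : ℕ, ((padicGammaNat p n : ℤ) : ZMod (p ^ N))
      = ∏ k ∈ Finset.range n, φ (k : ZMod (p ^ N)) := by
    intro n
    simp only [padicGammaNat, φ, Finset.prod_neg, Finset.card_range]
    push_cast
    congr 1
    rw [Finset.prod_filter]
    refine Finset.prod_congr rfl fun k _ => ?_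
    have hu : IsUnit (k : ZMod (p ^ N)) ↔ Nat.Coprime k p := by
      rw [ZMod.isUnit_iff_coprime, Nat.coprime_pow_right_iff (Nat.pos_of_ne_zero hN)]
    by_cases hc : Nat.Coprime k p
    · rw [if_pos (hu.2 hc)]
      by_cases hk : 1 < k
      · rw [if_pos ⟨hk, hc⟩]
      · rw [if_neg (fun h => hk h.1)]
        have : k = 1 := by
          rcases Nat.eq_zero_or_pos k with h0 | h0
          · subst h0
            exact absurd (by simpa using hc) hp.one_lt.ne'
          · omega
        simp [this]
    · rw [if_neg (fun h => hc h.2), if_neg (fun h => hc (hu.1 h))]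
  have hfull : ∏ x : ZMod (p ^ N), φ x = 1 := by
    simp only [φ, Finset.prod_neg, Finset.card_univ, ZMod.card, hodd.neg_one_pow]
    have : ∏ x : ZMod (p ^ N), (if IsUnit x then x else 1) = -1 := by
      rw [← Finset.prod_filter]
      have h1 := congrArg Units.val (zmod_prod_units_prime_pow (p := p) (N := N) hp2)
      rw [Units.coe_prod] at h1
      rw [Units.val_neg, Units.val_one] at h1
      rw [← h1]
      symm
      refine Finset.prod_bij (fun u _ => (u : ZMod (p ^ N))) ?_ ?_ ?_ ?_
      · intro u _
        simp
      · intro u _ v _ h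
        exact Units.ext h
      · intro x hx
        obtain ⟨u, hu⟩ := (Finset.mem_filter.1 hx).2
        exact ⟨u, Finset.mem_univ _, hu⟩
      · intro u _
        rfl
    rw [this]
    ring
  have hshift : ∏ k ∈ Finset.range (p ^ N), φ ((m + k : ℕ) : ZMod (p ^ N)) = 1 := by
    rw [← hfull, ← Equiv.prod_comp (Equiv.addLeft (m : ZMod (p ^ N))) φ]
    refine Finset.prod_nbij' (fun k => (k : ZMod (p ^ N))) ZMod.val ?_ ?_ ?_ ?_ ?_
    · intro k _
      exact Finset.mem_univ _
    · intro x _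
      exact Finset.mem_range.2 (ZMod.val_lt x)
    · intro k hk
      exact ZMod.val_cast_of_lt (Finset.mem_range.1 hk)
    · intro x _
      exact ZMod.natCast_zmod_val x
    · intro k _
      simp
  rw [hg, hg, Finset.prod_range_add, hshift, mul_one]

theorem norm_padicGammaNat_sub_le {p N : ℕ} [Fact p.Prime] (hp2 : p ≠ 2) (hN : N ≠ 0) {m n : ℕ}
    (h : ‖(m : ℚ_[p]) - n‖ ≤ (p : ℝ) ^ (-(N : ℤ))) :
    ‖(padicGammaNat p m : ℚ_[p]) - padicGammaNat p n‖ ≤ (p : ℝ) ^ (-(N : ℤ)) := by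
  wlog hmn : n ≤ m generalizing m n
  · rw [norm_sub_rev] at h ⊢
    exact this h (le_of_not_ge hmn)
  have h1 : ((p ^ N : ℕ) : ℤ) ∣ ((m : ℤ) - n) := by
    have := (Padic.norm_int_le_pow_iff_dvd (p := p) ((m : ℤ) - n) N).1 (by push_cast; exact h)
    exact_mod_cast this
  obtain ⟨d, rfl⟩ := Nat.exists_eq_add_of_le hmn
  have h2 : p ^ N ∣ d := by
    have : ((p ^ N : ℕ) : ℤ) ∣ (d : ℤ) := by
      have e : ((n + d : ℕ) : ℤ) - n = d := by push_cast; ring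
      rwa [e] at h1
    exact_mod_cast this
  obtain ⟨c, rfl⟩ := h2
  have h3 : ∀ c : ℕ, ((padicGammaNat p (n + p ^ N * c) : ℤ) : ZMod (p ^ N))
      = (padicGammaNat p n : ℤ) := by
    intro c
    induction c with
    | zero => simp
    | succ c ih => rw [Nat.mul_succ, ← add_assoc, padicGammaNat_add_pow hp2 hN, ih]
  have h4 : ((padicGammaNat p (n + p ^ N * c) - padicGammaNat p n : ℤ) : ZMod (p ^ N)) = 0 := by
    push_cast
    rw [h3 c, sub_self]
  have h5 := (ZMod.intCast_zmod_eq_zero_iff_dvd _ _).1 h4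
  have h6 := (Padic.norm_int_le_pow_iff_dvd (p := p)
    (padicGammaNat p (n + p ^ N * c) - padicGammaNat p n) N).2 (by exact_mod_cast h5)
  simpa using h6

/-- The limit defining the `p`-adic Gamma function exists at every `p`-adic integer, `p` odd. -/
theorem tendsto_padicGamma {p : ℕ} [Fact p.Prime] (hp2 : p ≠ 2) (x : ℤ_[p]) :
    (comap (fun m : ℕ => (m : ℚ_[p])) (𝓝 (x : ℚ_[p]))).NeBot ∧
    Tendsto (fun m : ℕ => (padicGammaNat p m : ℚ_[p]))
      (comap (fun m : ℕ => (m : ℚ_[p])) (𝓝 (x : ℚ_[p]))) (𝓝 (padicGamma p (x : ℚ_[p]))) := by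
  have hp : p.Prime := Fact.out
  have hne : (comap (fun m : ℕ => (m : ℚ_[p])) (𝓝 (x : ℚ_[p]))).NeBot := by
    rw [comap_neBot_iff]
    intro t ht
    obtain ⟨ε, hε, hball⟩ := Metric.mem_nhds_iff.1 ht
    obtain ⟨m, hm⟩ := PadicInt.denseRange_natCast.exists_dist_lt x hε
    refine ⟨m, hball ?_⟩
    rw [Metric.mem_ball, dist_comm]
    simpa [dist_eq_norm, ← PadicInt.padic_norm_e_of_padicInt] using hm
  refine ⟨hne, ?_⟩
  refine tendsto_nhds_limUnder (cauchy_map_iff_exists_tendsto.1 ?_)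
  rw [Metric.cauchy_iff]
  refine ⟨hne.map _, fun ε hε => ?_⟩
  have hp1 : (1 : ℝ) < p := by exact_mod_cast hp.one_lt
  have hp0 : (0 : ℝ) < p := zero_lt_one.trans hp1
  obtain ⟨N, hN⟩ := exists_pow_lt_of_lt_one hε (inv_lt_one_of_one_lt₀ hp1)
  have hlt : (p : ℝ) ^ (-((N + 1 : ℕ) : ℤ)) < ε := by
    refine lt_of_le_of_lt ?_ hN
    rw [inv_pow, zpow_neg, zpow_natCast]
    exact inv_anti₀ (pow_pos hp0 _) (pow_le_pow_right₀ hp1.le (Nat.le_succ N))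
  have hpos : 0 < (p : ℝ) ^ (-((N + 1 : ℕ) : ℤ)) := zpow_pos hp0 _
  refine ⟨_, image_mem_map (preimage_mem_comap (Metric.ball_mem_nhds (x : ℚ_[p]) hpos)), ?_⟩
  rintro _ ⟨m, hm, rfl⟩ _ ⟨n, hn, rfl⟩
  rw [dist_eq_norm]
  refine lt_of_le_of_lt (norm_padicGammaNat_sub_le hp2 (Nat.succ_ne_zero N) ?_) hlt
  simp only [Set.mem_preimage, Metric.mem_ball, dist_eq_norm] at hm hn
  have e : (m : ℚ_[p]) - n = ((m : ℚ_[p]) - x) + -((n : ℚ_[p]) - x) := by ring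
  rw [e]
  refine (Padic.nonarchimedean _ _).trans (max_le hm.le ?_)
  rw [norm_neg]
  exact hn.le

/-! ### Morita's Gamma function on `ℤ_[p]`: functional equation, reflection, value at 1/2. -/

section

variable {p : ℕ} [Fact p.Prime]

/-! Put F(x) = ∑_{k<p^r} C(x,k) C(x+k,k) C(-1/2,k), the given series, and G(x) = (-1)^((p+1)/2)
Γ_p((1+x)/2)² Γ_p(-x/2)². The claim is F(a) ≡ G(a)^r mod p². Both functions are invariant under x ↦
-1-x.

At natural n < p^r the sum terminates, and creative telescoping (`chooseSum_recurrence`) gives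
(n+2)² F(n+2) = (n+1)² F(n). G obeys the same recurrence with every factor divisible by p replaced
by 1. Comparing the two gives F(s+pn) = F(n) G(s+pn) for an even digit s and even n
(`chooseSum_digit`), so F splits digit by digit.

For these a one has a = s₀ + p a' with a' equal to a or -1-a, so each digit of a is s₀ or p-1-s₀,
all even. Truncating a after r digits gives n with F(n) ≡ G(a)^(r-1) G(s), s being the top digit:
the other digits see enough of the expansion to give G(a) mod p².

To pass from n to a, note that mod p² both y ↦ F(n + p^r y) and y ↦ G(s + p y) are affine.
Interpolating both from y = 0 and y = -1 turns G(s) into the missing factor G(a). The node n - p^r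
is reflected to p^r-1-n, which again has even digits. -/

theorem toZModPow_eq_iff_dvd (N : ℕ) (x y : ℤ_[p]) :
    PadicInt.toZModPow N x = PadicInt.toZModPow N y ↔ (p : ℤ_[p]) ^ N ∣ x - y := by
  rw [← sub_eq_zero, ← map_sub, ← RingHom.mem_ker, PadicInt.ker_toZModPow,
    Ideal.mem_span_singleton]

theorem toZModPow_eq_iff_norm (N : ℕ) (x y : ℤ_[p]) :
    PadicInt.toZModPow N x = PadicInt.toZModPow N y ↔
      ‖(x : ℚ_[p]) - y‖ ≤ (p : ℝ) ^ (-(N : ℤ)) := by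
  rw [toZModPow_eq_iff_dvd, ← Ideal.mem_span_singleton, ← PadicInt.norm_le_pow_iff_mem_span_pow,
    ← PadicInt.coe_sub, PadicInt.norm_def]

theorem exists_nat_toZModPow_eq (N : ℕ) (x : ℤ_[p]) :
    ∃ m : ℕ, PadicInt.toZModPow N x = (m : ZMod (p ^ N)) := by
  have : NeZero (p ^ N) := ⟨pow_ne_zero _ (Fact.out : p.Prime).ne_zero⟩
  exact ⟨(PadicInt.toZModPow N x).val, (ZMod.natCast_zmod_val _).symm⟩

theorem norm_padicGamma_le_one (hp2 : p ≠ 2) (x : ℤ_[p]) : ‖padicGamma p (x : ℚ_[p])‖ ≤ 1 := by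
  obtain ⟨hne, ht⟩ := tendsto_padicGamma hp2 x
  exact le_of_tendsto ht.norm (Eventually.of_forall fun m => Padic.norm_int_le_one _)

open Classical in
/-- Morita's `p`-adic Gamma function as a self-map of `ℤ_[p]`. -/
noncomputable def gammaInt (x : ℤ_[p]) : ℤ_[p] :=
  -- For odd p the default 0 is never taken, by `norm_padicGamma_le_one`.
  ⟨if ‖padicGamma p (x : ℚ_[p])‖ ≤ 1 then padicGamma p (x : ℚ_[p]) else 0, by
    split_ifs with h
    · exact h
    · simp⟩

theorem coe_gammaInt (hp2 : p ≠ 2) (x : ℤ_[p]) :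
    (gammaInt x : ℚ_[p]) = padicGamma p (x : ℚ_[p]) :=
  if_pos (norm_padicGamma_le_one hp2 x)

theorem toZModPow_gammaInt (hp2 : p ≠ 2) {N : ℕ} (hN : N ≠ 0) {x : ℤ_[p]} {m : ℕ}
    (h : PadicInt.toZModPow N x = (m : ZMod (p ^ N))) :
    PadicInt.toZModPow N (gammaInt x) = (padicGammaNat p m : ZMod (p ^ N)) := by
  have hp : p.Prime := Fact.out
  have h1 : ‖(x : ℚ_[p]) - m‖ ≤ (p : ℝ) ^ (-(N : ℤ)) := by
    have := (toZModPow_eq_iff_norm N x (m : ℤ_[p])).1 (by rw [h, map_natCast])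
    simpa using this
  obtain ⟨hne, ht⟩ := tendsto_padicGamma hp2 x
  have hpos : 0 < (p : ℝ) ^ (-(N : ℤ)) := zpow_pos (by exact_mod_cast hp.pos) _
  have hev : ∀ᶠ n : ℕ in comap (fun m : ℕ => (m : ℚ_[p])) (𝓝 (x : ℚ_[p])),
      ‖(padicGammaNat p n : ℚ_[p]) - padicGammaNat p m‖ ≤ (p : ℝ) ^ (-(N : ℤ)) := by
    filter_upwards [preimage_mem_comap (Metric.ball_mem_nhds (x : ℚ_[p]) hpos)] with n hn
    refine norm_padicGammaNat_sub_le hp2 hN ?_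
    simp only [Set.mem_preimage, Metric.mem_ball, dist_eq_norm] at hn
    have e : (n : ℚ_[p]) - m = ((n : ℚ_[p]) - x) + ((x : ℚ_[p]) - m) := by ring
    rw [e]
    exact (Padic.nonarchimedean _ _).trans (max_le hn.le h1)
  have h2 := le_of_tendsto (ht.sub_const _).norm hev
  have h3 := (toZModPow_eq_iff_norm N (gammaInt x) (padicGammaNat p m : ℤ_[p])).2 (by
    rw [coe_gammaInt hp2]
    simpa using h2)
  rw [h3, map_intCast]

theorem gammaInt_congr (hp2 : p ≠ 2) {N : ℕ} {x y : ℤ_[p]}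
    (h : PadicInt.toZModPow N x = PadicInt.toZModPow N y) :
    PadicInt.toZModPow N (gammaInt x) = PadicInt.toZModPow N (gammaInt y) := by
  rcases eq_or_ne N 0 with rfl | hN
  · rw [toZModPow_eq_iff_dvd]
    simp
  · obtain ⟨m, hm⟩ := exists_nat_toZModPow_eq N x
    rw [toZModPow_gammaInt hp2 hN hm, toZModPow_gammaInt hp2 hN (h.symm.trans hm)]

open Classical in
/-- The unit part used in the functional equation of the `p`-adic Gamma function. -/
noncomputable def unitOrOne (x : ℤ_[p]) : ℤ_[p] := if IsUnit x then x else 1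

theorem padicGammaNat_succ (m : ℕ) :
    padicGammaNat p (m + 1) = -(if Nat.Coprime m p then (m : ℤ) else 1) * padicGammaNat p m := by
  have hp : p.Prime := Fact.out
  simp only [padicGammaNat, Finset.prod_filter, Finset.prod_range_succ, pow_succ]
  have : (if 1 < m ∧ m.Coprime p then (m : ℤ) else 1) = if Nat.Coprime m p then (m : ℤ) else 1 := by
    by_cases hc : Nat.Coprime m p
    · by_cases h1 : 1 < m
      · simp [h1]
      · have : m ≠ 0 := by
          rintro rfl
          exact hp.one_lt.ne' (by simpa using hc)
        have : m = 1 := by omega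
        simp [this]
    · simp [hc]
  rw [this]
  ring

theorem isUnit_iff_not_dvd (x : ℤ_[p]) : IsUnit x ↔ ¬ (p : ℤ_[p]) ∣ x := by
  rw [PadicInt.isUnit_iff, ← PadicInt.norm_lt_one_iff_dvd]
  exact ⟨fun h => by simp [h], fun h => le_antisymm x.norm_le_one (not_lt.1 h)⟩

theorem isUnit_natCast_iff (m : ℕ) : IsUnit (m : ℤ_[p]) ↔ Nat.Coprime m p := by
  rw [PadicInt.isUnit_iff, PadicInt.norm_natCast_eq_one_iff, Nat.coprime_comm]

theorem isUnit_congr {x y : ℤ_[p]} (h : (p : ℤ_[p]) ∣ x - y) : IsUnit x ↔ IsUnit y := by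
  rw [isUnit_iff_not_dvd, isUnit_iff_not_dvd, dvd_iff_dvd_of_dvd_sub h]

theorem gammaInt_add_one (hp2 : p ≠ 2) (x : ℤ_[p]) :
    gammaInt (x + 1) = -unitOrOne x * gammaInt x := by
  refine PadicInt.ext_of_toZModPow.1 fun N => ?_
  rcases eq_or_ne N 0 with rfl | hN
  · rw [toZModPow_eq_iff_dvd]
    simp
  obtain ⟨m, hm⟩ := exists_nat_toZModPow_eq N x
  have h1 : PadicInt.toZModPow N (x + 1) = ((m + 1 : ℕ) : ZMod (p ^ N)) := by
    rw [map_add, hm]; simp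
  have h2 : IsUnit x ↔ Nat.Coprime m p := by
    rw [← isUnit_natCast_iff]
    refine isUnit_congr ((dvd_pow_self _ hN).trans ((toZModPow_eq_iff_dvd N _ _).1 ?_))
    rw [hm, map_natCast]
  rw [toZModPow_gammaInt hp2 hN h1, padicGammaNat_succ, map_mul, toZModPow_gammaInt hp2 hN hm]
  push_cast
  rw [map_neg, unitOrOne]
  congr 2
  by_cases hc : Nat.Coprime m p
  · rw [if_pos (h2.2 hc), if_pos hc, hm]
  · rw [if_neg (fun h => hc (h2.1 h)), if_neg hc, map_one]

theorem gammaInt_zero (hp2 : p ≠ 2) : gammaInt (0 : ℤ_[p]) = 1 := by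
  refine PadicInt.ext_of_toZModPow.1 fun N => ?_
  rcases eq_or_ne N 0 with rfl | hN
  · rw [toZModPow_eq_iff_dvd]
    simp
  rw [toZModPow_gammaInt hp2 hN (m := 0) (by simp)]
  simp [padicGammaNat]

open Classical in
theorem unitOrOne_neg (x : ℤ_[p]) :
    unitOrOne (-x) = if IsUnit x then -unitOrOne x else unitOrOne x := by
  by_cases h : IsUnit x <;> simp [unitOrOne, h]

open Classical in
/-- One step of the reflection formula. -/
theorem gammaInt_reflection_step (hp2 : p ≠ 2) (x : ℤ_[p]) :
    gammaInt (x + 1) * gammaInt (1 - (x + 1)) =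
      (if IsUnit x then -1 else 1) * (gammaInt x * gammaInt (1 - x)) := by
  have h := gammaInt_add_one hp2 (-x)
  rw [show -x + 1 = 1 - x by ring, unitOrOne_neg] at h
  rw [h, gammaInt_add_one hp2 x, show 1 - (x + 1) = -x by ring]
  split_ifs <;> ring

theorem gammaInt_reflection_nat (hp2 : p ≠ 2) (m : ℕ) :
    gammaInt (m : ℤ_[p]) * gammaInt (1 - (m : ℤ_[p])) =
      -∏ k ∈ Finset.range m, (if Nat.Coprime k p then -1 else 1) := by
  induction m with
  | zero =>
    have := gammaInt_add_one hp2 (0 : ℤ_[p])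
    simp [unitOrOne, gammaInt_zero hp2] at this
    simp [gammaInt_zero hp2, this]
  | succ m ih =>
    rw [Nat.cast_succ, gammaInt_reflection_step hp2, ih, Finset.prod_range_succ]
    simp only [isUnit_natCast_iff]
    ring

/-- Modulo p^N one may replace x by a natural number, where the product is a sign; squaring avoids
having to track that sign. -/
theorem gammaInt_reflection_sq (hp2 : p ≠ 2) (x : ℤ_[p]) :
    (gammaInt x * gammaInt (1 - x)) ^ 2 = 1 := by
  refine PadicInt.ext_of_toZModPow.1 fun N => ?_
  obtain ⟨m, hm⟩ := exists_nat_toZModPow_eq N x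
  have h1 : PadicInt.toZModPow N x = PadicInt.toZModPow N (m : ℤ_[p]) := by rw [hm, map_natCast]
  have h2 : PadicInt.toZModPow N (1 - x) = PadicInt.toZModPow N (1 - m : ℤ_[p]) := by
    rw [map_sub, h1, map_sub]
  rw [map_pow, map_mul, gammaInt_congr hp2 h1, gammaInt_congr hp2 h2, ← map_mul,
    gammaInt_reflection_nat hp2, ← map_pow, neg_sq, ← Finset.prod_pow]
  congr 1
  exact Finset.prod_eq_one fun k _ => by split_ifs <;> simp

theorem isUnit_gammaInt (hp2 : p ≠ 2) (x : ℤ_[p]) : IsUnit (gammaInt x) := by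
  refine IsUnit.of_mul_eq_one (gammaInt x * gammaInt (1 - x) ^ 2) ?_
  linear_combination gammaInt_reflection_sq hp2 x

/-- As 1 - 1/2 = 1/2, reflection makes the fourth power 1, so the square is ±1. The sign is read off
mod p, where 1/2 is q+1 with p = 2q+1. -/
theorem gammaInt_half_sq (hp2 : p ≠ 2) {h : ℤ_[p]} (hh : 2 * h = 1) :
    gammaInt h ^ 2 = (-1) ^ ((p + 1) / 2) := by
  have hp : p.Prime := Fact.out
  obtain ⟨q, hq⟩ := hp.odd_of_ne_two hp2
  have hh' : 1 - h = h := by linear_combination -hh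
  have h1 := gammaInt_reflection_sq hp2 h
  rw [hh', ← sq] at h1
  have e : h - ((q + 1 : ℕ) : ℤ_[p]) = p * (-h) := by
    have : (p : ℤ_[p]) = 2 * q + 1 := by exact_mod_cast congrArg (Nat.cast : ℕ → ℤ_[p]) hq
    rw [this]
    push_cast
    linear_combination ((q : ℤ_[p]) + 1) * hh
  have h2 : PadicInt.toZModPow 1 h = PadicInt.toZModPow 1 ((q + 1 : ℕ) : ℤ_[p]) := by
    rw [toZModPow_eq_iff_dvd, e, pow_one]
    exact Dvd.intro _ rfl
  have h3 : PadicInt.toZModPow 1 h = PadicInt.toZModPow 1 (1 - ((q + 1 : ℕ) : ℤ_[p])) := by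
    rw [map_sub, ← h2, ← map_sub, hh']
  have h4 : PadicInt.toZModPow 1 (gammaInt h ^ 2) =
      PadicInt.toZModPow 1 ((-1 : ℤ_[p]) ^ ((p + 1) / 2)) := by
    rw [sq, map_mul]
    nth_rewrite 1 [gammaInt_congr hp2 h2]
    rw [gammaInt_congr hp2 h3, ← map_mul, gammaInt_reflection_nat hp2, Finset.prod_range_succ']
    congr 1
    have : ∀ k ∈ Finset.range q, (if Nat.Coprime (k + 1) p then (-1 : ℤ_[p]) else 1) = -1 := by
      intro k hk
      have hk := Finset.mem_range.1 hk
      rw [if_pos (Nat.coprime_of_lt_prime (by omega) (by omega) hp).symm]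
    rw [Finset.prod_congr rfl this, Finset.prod_const, Finset.card_range,
      show (p + 1) / 2 = q + 1 by omega, pow_succ]
    simp [hp.one_lt.ne']
  have h5 : (gammaInt h ^ 2 - 1) * (gammaInt h ^ 2 + 1) = 0 := by
    linear_combination h1
  have h6 : ¬ (p : ℤ_[p]) ∣ 2 := by
    rw [← isUnit_iff_not_dvd]
    exact IsUnit.of_mul_eq_one h hh
  rw [toZModPow_eq_iff_dvd, pow_one] at h4
  -- If the two signs differed, p would divide 2.
  rcases mul_eq_zero.1 h5 with h7 | h7 <;> rcases neg_one_pow_eq_or ℤ_[p] ((p + 1) / 2) with h8 | h8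
  · rw [h8]; linear_combination h7
  · refine absurd ?_ h6
    rw [h8] at h4
    convert h4 using 1
    linear_combination -h7
  · refine absurd ?_ h6
    rw [h8, ← dvd_neg] at h4
    convert h4 using 1
    linear_combination h7
  · rw [h8]; linear_combination h7

end

/-! ### Affine functions modulo p², and the local behaviour of the Gamma function. -/

section

variable {p : ℕ} [Fact p.Prime]

/-- The function `h` is affine modulo `p ^ 2` with slope divisible by `p`. -/
def IsAffineModSq (h : ℤ_[p] → ZMod (p ^ 2)) : Prop :=
  ∃ c : ZMod (p ^ 2), ∀ y, h y = h 0 + (p : ZMod (p ^ 2)) * PadicInt.toZModPow 2 y * c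

omit [Fact p.Prime] in
theorem natCast_prime_sq : (p : ZMod (p ^ 2)) ^ 2 = 0 := by
  rw [← Nat.cast_pow, ZMod.natCast_self]

namespace IsAffineModSq

variable {h k : ℤ_[p] → ZMod (p ^ 2)}

theorem const (c : ZMod (p ^ 2)) : IsAffineModSq (p := p) fun _ => c :=
  ⟨0, fun y => by ring⟩

theorem add (hh : IsAffineModSq h) (hk : IsAffineModSq k) :
    IsAffineModSq fun y => h y + k y := by
  obtain ⟨c, hc⟩ := hh
  obtain ⟨d, hd⟩ := hk
  exact ⟨c + d, fun y => by beta_reduce; rw [hc y, hd y]; ring⟩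

theorem mul (hh : IsAffineModSq h) (hk : IsAffineModSq k) :
    IsAffineModSq fun y => h y * k y := by
  obtain ⟨c, hc⟩ := hh
  obtain ⟨d, hd⟩ := hk
  refine ⟨c * k 0 + h 0 * d, fun y => ?_⟩
  beta_reduce
  rw [hc y, hd y]
  linear_combination (PadicInt.toZModPow 2 y ^ 2 * c * d) * natCast_prime_sq (p := p)

theorem sum {ι : Type*} (s : Finset ι) {f : ι → ℤ_[p] → ZMod (p ^ 2)}
    (hf : ∀ i ∈ s, IsAffineModSq (f i)) : IsAffineModSq fun y => ∑ i ∈ s, f i y := by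
  classical
  induction s using Finset.induction_on with
  | empty => simpa using const 0
  | insert i s hi ih =>
    simp only [Finset.sum_insert hi]
    exact (hf i (Finset.mem_insert_self i s)).add
      (ih fun j hj => hf j (Finset.mem_insert_of_mem hj))

theorem comp_mul_left (hh : IsAffineModSq h) (u : ℤ_[p]) : IsAffineModSq fun y => h (u * y) := by
  obtain ⟨c, hc⟩ := hh
  refine ⟨PadicInt.toZModPow 2 u * c, fun y => ?_⟩
  beta_reduce
  rw [mul_zero, hc (u * y), map_mul]
  ring

/-- Interpolation from the values at `0` and `-1`. -/
theorem eq_interpolate (hh : IsAffineModSq h) (y : ℤ_[p]) :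
    h y = (1 + PadicInt.toZModPow 2 y) * h 0 - PadicInt.toZModPow 2 y * h (-1) := by
  obtain ⟨c, hc⟩ := hh
  rw [hc y, hc (-1), map_neg, map_one]
  ring

end IsAffineModSq

theorem natCast_mul_toZModPow_eq_zero {e : ℤ_[p]} (h : (p : ℤ_[p]) ∣ e) :
    (p : ZMod (p ^ 2)) * PadicInt.toZModPow 2 e = 0 := by
  obtain ⟨d, rfl⟩ := h
  rw [map_mul, map_natCast]
  linear_combination PadicInt.toZModPow 2 d * natCast_prime_sq (p := p)

theorem toZMod_eq_zero_iff (x : ℤ_[p]) : PadicInt.toZMod x = 0 ↔ (p : ℤ_[p]) ∣ x := by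
  rw [← RingHom.mem_ker, PadicInt.ker_toZMod, PadicInt.maximalIdeal_eq_span_p,
    Ideal.mem_span_singleton]

/-- First-order Taylor expansion, exact because p² = 0. Modulo p the slope is the product times its
logarithmic derivative; non-units contribute the constant factor 1, matched by 0⁻¹ = 0. -/
theorem exists_prod_unitOrOne_add {ι : Type*} (s : Finset ι) (x : ι → ℤ_[p]) :
    ∃ e : ℤ_[p], PadicInt.toZMod e = PadicInt.toZMod (∏ i ∈ s, unitOrOne (x i)) *
        ∑ i ∈ s, (PadicInt.toZMod (x i))⁻¹ ∧
      ∀ y : ℤ_[p], PadicInt.toZModPow 2 (∏ i ∈ s, unitOrOne (x i + (p : ℤ_[p]) * y)) =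
        PadicInt.toZModPow 2 (∏ i ∈ s, unitOrOne (x i)) +
          (p : ZMod (p ^ 2)) * PadicInt.toZModPow 2 y * PadicInt.toZModPow 2 e := by
  classical
  induction s using Finset.induction_on with
  | empty => exact ⟨0, by simp, by simp⟩
  | insert i s hi ih =>
    obtain ⟨e, he, hy⟩ := ih
    have hu : ∀ y : ℤ_[p], IsUnit (x i + (p : ℤ_[p]) * y) ↔ IsUnit (x i) := fun y =>
      isUnit_congr (Dvd.intro y (by ring))
    simp only [Finset.prod_insert hi, Finset.sum_insert hi]
    by_cases h : IsUnit (x i)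
    · refine ⟨x i * e + ∏ j ∈ s, unitOrOne (x j), ?_, fun y => ?_⟩
      · have h0 : PadicInt.toZMod (x i) ≠ 0 := by
          rwa [Ne, toZMod_eq_zero_iff, ← isUnit_iff_not_dvd]
        simp only [unitOrOne, if_pos h] at he ⊢
        rw [map_add, map_mul, map_mul, he]
        field_simp
        ring
      · have h1 : unitOrOne (x i + (p : ℤ_[p]) * y) = x i + p * y := if_pos ((hu y).2 h)
        have h2 : unitOrOne (x i) = x i := if_pos h
        rw [h1, h2]
        simp only [map_mul (PadicInt.toZModPow 2), map_add, hy y, map_natCast]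
        linear_combination (PadicInt.toZModPow 2 y ^ 2 * PadicInt.toZModPow 2 e) *
          natCast_prime_sq (p := p)
    · have h2 : ∀ y : ℤ_[p], unitOrOne (x i + (p : ℤ_[p]) * y) = 1 :=
        fun y => if_neg fun h' => h ((hu y).1 h')
      have h3 : unitOrOne (x i) = 1 := if_neg h
      refine ⟨e, ?_, fun y => ?_⟩
      · rw [h3, one_mul, he]
        have h0 : PadicInt.toZMod (x i) = 0 := by
          rwa [toZMod_eq_zero_iff, ← not_not (a := (p : ℤ_[p]) ∣ x i), ← isUnit_iff_not_dvd]
        rw [h0, inv_zero, zero_add]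
      · rw [h2, h3, one_mul, one_mul, hy y]

/-- Translation and inversion permute `ZMod p`, and its elements sum to 0 for p > 2. -/
theorem sum_range_add_inv (hp2 : p ≠ 2) (t : ZMod p) :
    ∑ i ∈ Finset.range p, (t + (i : ZMod p))⁻¹ = 0 := by
  have hp : p.Prime := Fact.out
  have h1 : ∑ i ∈ Finset.range p, (t + (i : ZMod p))⁻¹ = ∑ x : ZMod p, (t + x)⁻¹ := by
    refine Finset.sum_nbij' (fun k => (k : ZMod p)) ZMod.val ?_ ?_ ?_ ?_ ?_
    · intro k _
      exact Finset.mem_univ _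
    · intro x _
      exact Finset.mem_range.2 (ZMod.val_lt x)
    · intro k hk
      exact ZMod.val_cast_of_lt (Finset.mem_range.1 hk)
    · intro x _
      exact ZMod.natCast_zmod_val x
    · intro k _
      rfl
  rw [h1, Fintype.sum_equiv (Equiv.addLeft t) (fun x => (t + x)⁻¹) (fun x : ZMod p => x⁻¹)
    fun _ => rfl]
  have h2 : ∑ x : ZMod p, x⁻¹ = ∑ x : ZMod p, x :=
    Fintype.sum_equiv (Equiv.inv (ZMod p)) _ _ fun _ => rfl
  have := hp.two_le
  have h3 := FiniteField.sum_pow_lt_card_sub_one (ZMod p) 1 (by rw [ZMod.card]; omega)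
  simpa [h2] using h3

theorem gammaInt_add_natCast (hp2 : p ≠ 2) (x : ℤ_[p]) (n : ℕ) :
    gammaInt (x + (n : ℤ_[p])) = (-1) ^ n * (∏ i ∈ Finset.range n, unitOrOne (x + (i : ℤ_[p]))) * gammaInt x := by
  induction n with
  | zero => simp
  | succ n ih =>
    rw [Nat.cast_succ, ← add_assoc, gammaInt_add_one hp2, ih, Finset.prod_range_succ]
    ring

theorem toZModPow_prod_unitOrOne_add (hp2 : p ≠ 2) (x y : ℤ_[p]) :
    PadicInt.toZModPow 2 (∏ i ∈ Finset.range p, unitOrOne (x + (p : ℤ_[p]) * y + (i : ℤ_[p]))) =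
      PadicInt.toZModPow 2 (∏ i ∈ Finset.range p, unitOrOne (x + (i : ℤ_[p]))) := by
  obtain ⟨e, he, hy⟩ := exists_prod_unitOrOne_add (Finset.range p) fun i : ℕ => x + (i : ℤ_[p])
  simp only [map_add, map_natCast, sum_range_add_inv hp2, mul_zero, toZMod_eq_zero_iff] at he
  have h1 := hy y
  rw [mul_right_comm, natCast_mul_toZModPow_eq_zero he, zero_mul, add_zero] at h1
  rw [← h1]
  simp only [add_right_comm]

/-- The `p`-adic Gamma function is affine modulo `p ^ 2` on residue classes modulo `p`. -/
theorem isAffineModSq_gammaInt (hp2 : p ≠ 2) (x : ℤ_[p]) :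
    IsAffineModSq fun y => PadicInt.toZModPow 2 (gammaInt (x + (p : ℤ_[p]) * y)) := by
  -- V is Γ_p(x+p)/Γ_p(x). It is 1 mod p by continuity, and mod p² it depends only on x mod p, so
  -- Γ_p(x+pn) ≡ Vⁿ Γ_p(x) is affine in n.
  set V : ℤ_[p] := (-1) ^ p * ∏ i ∈ Finset.range p, unitOrOne (x + (i : ℤ_[p])) with hV
  have h1 : (p : ℤ_[p]) ∣ V - 1 := by
    have h2 : PadicInt.toZModPow 1 (gammaInt (x + (p : ℤ_[p]))) = PadicInt.toZModPow 1 (gammaInt x) :=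
      gammaInt_congr hp2 ((toZModPow_eq_iff_dvd 1 _ _).2 (by simp))
    rw [toZModPow_eq_iff_dvd, pow_one, gammaInt_add_natCast hp2, ← hV] at h2
    refine (isUnit_gammaInt hp2 x).dvd_mul_right.1 ?_
    convert h2 using 1
    ring
  obtain ⟨c, hc⟩ := h1
  have hn : ∀ n : ℕ, PadicInt.toZModPow 2 (gammaInt (x + (p : ℤ_[p]) * (n : ℤ_[p]))) =
      PadicInt.toZModPow 2 (gammaInt x) * (1 + (p : ZMod (p ^ 2)) * (n : ZMod (p ^ 2)) * PadicInt.toZModPow 2 c) := by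
    intro n
    induction n with
    | zero => simp
    | succ n ih =>
      have e : x + (p : ℤ_[p]) * ((n + 1 : ℕ) : ℤ_[p]) =
          x + (p : ℤ_[p]) * (n : ℤ_[p]) + (p : ℤ_[p]) := by push_cast; ring
      rw [e, gammaInt_add_natCast hp2, map_mul, map_mul, toZModPow_prod_unitOrOne_add hp2,
        ← map_mul, ← hV, ih, eq_add_of_sub_eq hc, map_add, map_one, map_mul, map_natCast]
      push_cast
      linear_combination (PadicInt.toZModPow 2 (gammaInt x) * n * PadicInt.toZModPow 2 c ^ 2) *
        natCast_prime_sq (p := p)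
  refine ⟨PadicInt.toZModPow 2 (gammaInt x) * PadicInt.toZModPow 2 c, fun y => ?_⟩
  obtain ⟨n, hy⟩ := exists_nat_toZModPow_eq 1 y
  rw [← map_natCast (PadicInt.toZModPow 1), toZModPow_eq_iff_dvd, pow_one] at hy
  have h2 : PadicInt.toZModPow 2 (x + (p : ℤ_[p]) * y) =
      PadicInt.toZModPow 2 (x + (p : ℤ_[p]) * (n : ℤ_[p])) := by
    rw [toZModPow_eq_iff_dvd, sq]
    refine (mul_dvd_mul_left (p : ℤ_[p]) hy).trans (Dvd.intro 1 (by ring))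
  have h3 := natCast_mul_toZModPow_eq_zero hy
  rw [map_sub, map_natCast] at h3
  beta_reduce
  rw [gammaInt_congr hp2 h2, hn, mul_zero, add_zero]
  linear_combination
    -(PadicInt.toZModPow 2 (gammaInt x) * PadicInt.toZModPow 2 c) * h3

end

/-! ### Binomial coefficients modulo p² and the recurrence for the sum. -/

section

theorem succ_mul_ringChoose_succ {R : Type*} [CommRing R] [BinomialRing R] (x : R) (k : ℕ) :
    ((k : R) + 1) * Ring.choose x (k + 1) = (x - k) * Ring.choose x k := by
  have h := Ring.choose_smul_choose x (Nat.le_succ k)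
  rw [show k.succ - k = 1 by omega, Ring.choose_one_right, Nat.choose_succ_self_right,
    nsmul_eq_mul] at h
  push_cast at h
  linear_combination h

theorem succ_mul_ringChoose_succ' {R : Type*} [CommRing R] [BinomialRing R] (x : R) (k : ℕ) :
    ((k : R) + 1) * Ring.choose x (k + 1) = x * Ring.choose (x - 1) k := by
  have h := Ring.choose_smul_choose x (Nat.le_add_left 1 k)
  rw [Nat.add_sub_cancel, Ring.choose_one_right, Nat.choose_one_right, nsmul_eq_mul] at h
  push_cast at h
  linear_combination h

variable {p : ℕ} [Fact p.Prime]

/-- The valuation of j is less than r, so p^r/j still contains a factor p. -/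
theorem exists_mul_eq_pow {r j : ℕ} (hj : j ≠ 0) (hjr : j < p ^ r) :
    ∃ q : ℤ_[p], (p : ℤ_[p]) ^ r = p * (q * j) := by
  have hp : p.Prime := Fact.out
  obtain ⟨t, u, hu, rfl⟩ := Nat.exists_eq_pow_mul_and_not_dvd hj p hp.ne_one
  have htr : t < r := by
    refine (Nat.pow_lt_pow_iff_right hp.one_lt).1 (lt_of_le_of_lt ?_ hjr)
    exact Nat.le_mul_of_pos_right _ (Nat.pos_of_ne_zero (by rintro rfl; simp at hu))
  have hu' : IsUnit (u : ℤ_[p]) := by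
    rw [isUnit_natCast_iff]
    exact ((Nat.Prime.coprime_iff_not_dvd hp).2 hu).symm
  obtain ⟨v, hv⟩ := hu'.exists_left_inv
  obtain ⟨d, rfl⟩ := Nat.exists_eq_add_of_lt htr
  refine ⟨p ^ d * v, ?_⟩
  push_cast
  linear_combination -((p : ℤ_[p]) ^ (t + d + 1)) * hv

theorem exists_choose_pow_mul {r j : ℕ} (hjr : j + 1 < p ^ r) :
    ∃ q : ℤ_[p], ∀ y : ℤ_[p], Ring.choose ((p : ℤ_[p]) ^ r * y) (j + 1) =
      p * (q * y * Ring.choose ((p : ℤ_[p]) ^ r * y - 1) j) := by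
  obtain ⟨q, hq⟩ := exists_mul_eq_pow (p := p) (Nat.succ_ne_zero j) hjr
  refine ⟨q, fun y => mul_left_cancel₀ (Nat.cast_add_one_ne_zero (R := ℤ_[p]) j) ?_⟩
  rw [succ_mul_ringChoose_succ']
  nth_rewrite 1 [hq]
  push_cast
  ring

/-- In the Vandermonde expansion every term but one contains some C(p^r y, j+1), which p divides. -/
theorem dvd_ringChoose_add_sub {r k : ℕ} (hk : k < p ^ r) (x y : ℤ_[p]) :
    (p : ℤ_[p]) ∣ Ring.choose (x + (p : ℤ_[p]) ^ r * y) k - Ring.choose x k := by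
  rw [Ring.add_choose_eq k (Commute.all _ _), Finset.Nat.sum_antidiagonal_eq_sum_range_succ_mk,
    Finset.sum_range_succ]
  simp only [Nat.sub_self, Ring.choose_zero_right, mul_one, add_sub_cancel_right]
  refine Finset.dvd_sum fun i hi => ?_
  have hi := Finset.mem_range.1 hi
  obtain ⟨j, hj⟩ := Nat.exists_eq_add_of_lt hi
  rw [show k - i = j + 1 by omega]
  obtain ⟨q, hq⟩ := exists_choose_pow_mul (p := p) (r := r) (j := j) (by omega)
  rw [hq y]
  exact (Dvd.intro _ rfl : (p : ℤ_[p]) ∣ _).mul_left _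

theorem isAffineModSq_choose_pow_mul {r j : ℕ} (hjr : j < p ^ r) :
    IsAffineModSq fun y : ℤ_[p] =>
      PadicInt.toZModPow 2 (Ring.choose ((p : ℤ_[p]) ^ r * y) j) := by
  rcases j with _ | j
  · simpa using IsAffineModSq.const 1
  obtain ⟨q, hq⟩ := exists_choose_pow_mul (p := p) hjr
  -- The factor C(p^r y - 1, j) is multiplied by p, so it matters only mod p, where it is C(-1, j).
  refine ⟨PadicInt.toZModPow 2 (q * Ring.choose (-1) j), fun y => ?_⟩
  have h := natCast_mul_toZModPow_eq_zero
    (dvd_ringChoose_add_sub (p := p) (r := r) (k := j) (by omega) (-1) y)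
  rw [show -1 + (p : ℤ_[p]) ^ r * y = (p : ℤ_[p]) ^ r * y - 1 by ring, map_sub] at h
  beta_reduce
  rw [hq y, hq 0]
  simp only [map_mul, map_natCast, map_zero]
  linear_combination PadicInt.toZModPow 2 q * PadicInt.toZModPow 2 y * h

theorem isAffineModSq_choose_add {r k : ℕ} (hk : k < p ^ r) (x : ℤ_[p]) :
    IsAffineModSq fun y : ℤ_[p] =>
      PadicInt.toZModPow 2 (Ring.choose (x + (p : ℤ_[p]) ^ r * y) k) := by
  simp only [fun y : ℤ_[p] => Ring.add_choose_eq k (Commute.all x ((p : ℤ_[p]) ^ r * y)), map_sum,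
    map_mul]
  refine IsAffineModSq.sum _ fun ij hij => (IsAffineModSq.const _).mul ?_
  have := Finset.HasAntidiagonal.mem_antidiagonal.1 hij
  exact isAffineModSq_choose_pow_mul (by omega)

/-- The truncated series `∑_{k<N} C(a,k) C(a+k,k) C(h,k)`. -/
noncomputable def chooseSum {R : Type*} [CommRing R] [BinomialRing R] (h : R) (N : ℕ) (a : R) : R :=
  ∑ k ∈ Finset.range N, Ring.choose a k * Ring.choose (a + k) k * Ring.choose h k

theorem isAffineModSq_chooseSum (h : ℤ_[p]) (r : ℕ) (x : ℤ_[p]) :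
    IsAffineModSq fun y : ℤ_[p] =>
      PadicInt.toZModPow 2 (chooseSum h (p ^ r) (x + (p : ℤ_[p]) ^ r * y)) := by
  simp only [chooseSum, map_sum, map_mul]
  refine IsAffineModSq.sum _ fun k hk => ?_
  have hk := Finset.mem_range.1 hk
  refine ((isAffineModSq_choose_add hk x).mul ?_).mul (IsAffineModSq.const _)
  simpa only [add_right_comm x] using isAffineModSq_choose_add hk (x + k)

/-- The reflection swaps C(a,k) and C(a+k,k), each up to (-1)^k, and the signs cancel. -/
theorem chooseSum_neg_one_sub {R : Type*} [CommRing R] [BinomialRing R] (h : R) (N : ℕ) (a : R) :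
    chooseSum h N (-1 - a) = chooseSum h N a := by
  refine Finset.sum_congr rfl fun k _ => ?_
  have h1 := Ring.choose_neg (a + 1) k
  have h2 := Ring.choose_neg (a + 1 - k) k
  rw [show -(a + 1) = -1 - a by ring, show a + 1 + k - 1 = a + k by ring] at h1
  rw [show -(a + 1 - k) = -1 - a + k by ring, show a + 1 - k + k - 1 = a by ring] at h2
  rw [h1, h2]
  rcases Int.units_eq_one_or (Int.negOnePow k) with h | h <;> simp [h, mul_comm]

theorem choose_cast_mul_sub {R : Type*} [CommRing R] (n k : ℕ) :
    ((k : R) + 1) * (n.choose (k + 1) : R) = (n - k) * n.choose k := by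
  have h1 : n.choose (k + 1) * (k + 1) = n.choose k * (n - k) := Nat.choose_succ_right_eq n k
  rcases le_or_gt k n with h | h
  · have h2 := congrArg (Nat.cast : ℕ → R) h1
    push_cast [h] at h2
    linear_combination h2
  · rw [Nat.choose_eq_zero_of_lt h, Nat.choose_eq_zero_of_lt (by omega)]
    simp

theorem choose_cast_succ_left {R : Type*} [CommRing R] (n k : ℕ) :
    ((n : R) + 1) * (n.choose k : R) = (n + 1 - k) * (n + 1).choose k := by
  rcases le_or_gt k (n + 1) with h | h
  · have h2 := congrArg (Nat.cast : ℕ → R) (Nat.choose_mul_succ_eq n k)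
    push_cast [h] at h2
    linear_combination h2
  · rw [Nat.choose_eq_zero_of_lt h, Nat.choose_eq_zero_of_lt (by omega)]
    simp

/-- A three-term recurrence obtained by creative telescoping. -/
theorem chooseSum_recurrence {R : Type*} [CommRing R] [BinomialRing R] [IsDomain R] [CharZero R]
    {h : R} (hh : 2 * h = -1) {N n : ℕ} (hn : n + 2 < N) :
    ((n : R) + 2) ^ 2 * chooseSum h N ((n + 2 : ℕ) : R) =
      ((n : R) + 1) ^ 2 * chooseSum h N (n : R) := by
  -- The telescoping certificate: k³ makes it vanish at 0 and C(n+2,k) at k = N > n+2.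
  let c : ℕ → R := fun k => -2 * (2 * n + 3) * (k : R) ^ 3 * Ring.choose h k *
    ((n + 2).choose k : R) * ((n + k).choose k : R)
  have hstep : ∀ k, ((n : R) + 1) * (n + 2) * ((n + 2) ^ 2 *
        (((n + 2).choose k : R) * ((n + 2 + k).choose k : R) * Ring.choose h k) -
      (n + 1) ^ 2 * ((n.choose k : R) * ((n + k).choose k : R) * Ring.choose h k)) =
      c (k + 1) - c k := by
    intro k
    have b := succ_mul_ringChoose_succ h k
    have a1 := choose_cast_succ_left (R := R) n k
    have a2 := choose_cast_succ_left (R := R) (n + 1) k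
    have a3 := choose_cast_succ_left (R := R) (n + k) k
    have a4 := choose_cast_succ_left (R := R) (n + k + 1) k
    have a5 := choose_cast_mul_sub (R := R) (n + 2) k
    have a6 := choose_cast_mul_sub (R := R) (n + k + 1) k
    simp only [c]
    rw [show n + 2 + k = n + k + 1 + 1 by ring, show n + (k + 1) = n + k + 1 by ring]
    push_cast at *
    generalize ((n + 2).choose k : R) = A at *
    generalize ((n + 1).choose k : R) = A1 at *
    generalize (n.choose k : R) = A0 at *
    generalize ((n + k).choose k : R) = B at *
    generalize ((n + k + 1).choose k : R) = B1 at *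
    generalize ((n + k + 1 + 1).choose k : R) = B2 at *
    generalize ((n + 2).choose (k + 1) : R) = A' at *
    generalize ((n + k + 1).choose (k + 1) : R) = B' at *
    generalize Ring.choose h k = C at *
    generalize Ring.choose h (k + 1) = C' at *
    -- Everything is now expressed through A·B·C; the hypothesis 2h = -1 enters only in `e3`.
    have e0 : ((n : R) + 1) * (n + 2) * A0 = (n + 1 - k) * (n + 2 - k) * A := by
      linear_combination ((n : R) + 2) * a1 + ((n : R) + 1 - k) * a2
    have e1 : ((n : R) + 1) * (n + 2) * B2 = (n + k + 1) * (n + k + 2) * B := by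
      linear_combination -((n : R) + 1) * a4 - ((n : R) + k + 2) * a3
    have e2 : ((k : R) + 1) * B' = (n + k + 1) * B := by
      linear_combination a6 - a3
    have e3 : 2 * ((k : R) + 1) * C' = -(2 * k + 1) * C := by
      linear_combination 2 * b + C * hh
    have e4 : 2 * ((k : R) + 1) ^ 3 * (A' * B' * C') =
        -((n + 2 - k) * (n + k + 1) * (2 * k + 1) * (A * B * C)) := by
      linear_combination (2 * (k + 1) ^ 2 * C' * B') * a5 +
        ((n + 2 - k) * A * (2 * (k + 1) * C')) * e2 + ((n + 2 - k) * A * (n + k + 1) * B) * e3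
    linear_combination ((n + 2) ^ 2 * A * C) * e1 - ((n + 1) ^ 2 * B * C) * e0 + (2 * n + 3) * e4
  have hsum : ∑ k ∈ Finset.range N, (c (k + 1) - c k) = 0 := by
    rw [Finset.sum_range_sub]
    simp [c, Nat.choose_eq_zero_of_lt hn]
  have hne : ((n : R) + 1) * (n + 2) ≠ 0 := by
    have : (((n + 1) * (n + 2) : ℕ) : R) ≠ 0 := Nat.cast_ne_zero.2 (by positivity)
    exact_mod_cast this
  refine sub_eq_zero.1 ((mul_eq_zero.1 ?_).resolve_left hne)
  rw [← hsum, ← Finset.sum_congr rfl fun k _ => hstep k, ← Finset.mul_sum, Finset.sum_sub_distrib,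
    ← Finset.mul_sum, ← Finset.mul_sum]
  simp only [chooseSum, ← Nat.cast_add, Ring.choose_natCast]

end

/-! ### Comparing the terminating sum with the Gamma product. -/

section

theorem chooseSum_eq_of_lt {R : Type*} [CommRing R] [BinomialRing R] (h : R) {n N : ℕ}
    (hN : n < N) : chooseSum h N (n : R) = chooseSum h (n + 1) (n : R) := by
  refine (Finset.sum_subset (Finset.range_subset_range.2 hN) fun k _ hk => ?_).symm
  rw [Ring.choose_natCast, Nat.choose_eq_zero_of_lt (by simpa using hk)]
  simp

variable {p : ℕ} [Fact p.Prime]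

/-- The product of `p`-adic Gamma values `(-1)^((p+1)/2) Γ((1+x)/2)² Γ(-x/2)²`, with `u = 1/2`. -/
noncomputable def gammaProd (u x : ℤ_[p]) : ℤ_[p] :=
  (-1) ^ ((p + 1) / 2) * gammaInt (u * (1 + x)) ^ 2 * gammaInt (-(u * x)) ^ 2

variable {u : ℤ_[p]}

theorem gammaProd_neg_one_sub (x : ℤ_[p]) : gammaProd u (-1 - x) = gammaProd u x := by
  rw [gammaProd, gammaProd, show u * (1 + (-1 - x)) = -(u * x) by ring,
    show -(u * (-1 - x)) = u * (1 + x) by ring]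
  ring

theorem gammaProd_zero (hp2 : p ≠ 2) (hu : 2 * u = 1) : gammaProd u 0 = 1 := by
  rw [gammaProd, add_zero, mul_one, mul_zero, neg_zero, gammaInt_zero hp2, gammaInt_half_sq hp2 hu,
    one_pow, mul_one, ← mul_pow]
  simp

theorem gammaProd_congr (hp2 : p ≠ 2) {N : ℕ} {x y : ℤ_[p]}
    (h : PadicInt.toZModPow N x = PadicInt.toZModPow N y) :
    PadicInt.toZModPow N (gammaProd u x) = PadicInt.toZModPow N (gammaProd u y) := by
  have h1 : PadicInt.toZModPow N (u * (1 + x)) = PadicInt.toZModPow N (u * (1 + y)) := by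
    simp only [map_mul, map_add, h]
  have h2 : PadicInt.toZModPow N (-(u * x)) = PadicInt.toZModPow N (-(u * y)) := by
    simp only [map_mul, map_neg, h]
  simp only [gammaProd, map_mul, map_pow, gammaInt_congr hp2 h1, gammaInt_congr hp2 h2]

theorem isAffineModSq_gammaProd (hp2 : p ≠ 2) (x : ℤ_[p]) :
    IsAffineModSq fun y : ℤ_[p] => PadicInt.toZModPow 2 (gammaProd u (x + (p : ℤ_[p]) * y)) := by
  have h1 := (isAffineModSq_gammaInt hp2 (u * (1 + x))).comp_mul_left u
  have h2 := (isAffineModSq_gammaInt hp2 (-(u * x))).comp_mul_left (-u)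
  have h := ((IsAffineModSq.const ((-1) ^ ((p + 1) / 2))).mul (h1.mul h1)).mul (h2.mul h2)
  convert h using 2 with y
  rw [gammaProd, show u * (1 + (x + (p : ℤ_[p]) * y)) = u * (1 + x) + p * (u * y) by ring,
    show -(u * (x + (p : ℤ_[p]) * y)) = -(u * x) + p * (-u * y) by ring]
  simp only [map_mul, map_pow, map_neg, map_one, sq]

/-- This is the recurrence of the sum with non-units replaced by 1; the signs in the functional
equation disappear on squaring. -/
theorem gammaProd_add_two (hp2 : p ≠ 2) (hu : 2 * u = 1) (x : ℤ_[p]) :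
    unitOrOne (1 + u * x) ^ 2 * gammaProd u (x + 2) =
      unitOrOne (u * (1 + x)) ^ 2 * gammaProd u x := by
  have h1 := gammaInt_add_one hp2 (u * (1 + x))
  have h2 := gammaInt_add_one hp2 (-(1 + u * x))
  have h3 : unitOrOne (-(1 + u * x)) ^ 2 = unitOrOne (1 + u * x) ^ 2 := by
    classical
    rw [unitOrOne_neg]
    split_ifs <;> ring
  rw [gammaProd, gammaProd, show u * (1 + (x + 2)) = u * (1 + x) + 1 by linear_combination hu,
    show -(u * (x + 2)) = -(1 + u * x) by linear_combination -hu, h1,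
    show -(u * x) = -(1 + u * x) + 1 by ring, h2, mul_pow (-unitOrOne (-(1 + u * x))), neg_sq,
    h3]
  ring

variable {F : ℕ → ℤ_[p]}

theorem isUnit_half (hu : 2 * u = 1) : IsUnit u :=
  IsUnit.of_mul_eq_one 2 (by rw [mul_comm, hu])

theorem gammaProd_two_mul_succ (hp2 : p ≠ 2) (hu : 2 * u = 1) (m : ℕ) :
    unitOrOne ((m : ℤ_[p]) + 1) ^ 2 * gammaProd u (2 * (m + 1) : ℕ) =
      unitOrOne (u * (2 * (m : ℤ_[p]) + 1)) ^ 2 * gammaProd u (2 * m : ℕ) := by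
  have h := gammaProd_add_two hp2 hu (2 * m)
  rw [show 1 + u * (2 * (m : ℤ_[p])) = m + 1 by linear_combination (m : ℤ_[p]) * hu,
    add_comm 1 (2 * (m : ℤ_[p]))] at h
  push_cast
  rw [mul_add, mul_one, h]

theorem succ_sq_mul_of_recurrence (hu : 2 * u = 1)
    (hF : ∀ n : ℕ, ((n : ℤ_[p]) + 2) ^ 2 * F (n + 2) = ((n : ℤ_[p]) + 1) ^ 2 * F n) (m : ℕ) :
    ((m : ℤ_[p]) + 1) ^ 2 * F (2 * (m + 1)) = (u * (2 * m + 1)) ^ 2 * F (2 * m) := by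
  have h := hF (2 * m)
  push_cast at h
  rw [show 2 * m + 2 = 2 * (m + 1) by ring] at h
  linear_combination u ^ 2 * h - (2 * u + 1) * ((m : ℤ_[p]) + 1) ^ 2 * F (2 * (m + 1)) * hu

theorem isUnit_natCast_iff_not_dvd (m : ℕ) : IsUnit (m : ℤ_[p]) ↔ ¬ p ∣ m := by
  rw [isUnit_natCast_iff, Nat.coprime_comm, (Fact.out : p.Prime).coprime_iff_not_dvd]

theorem isUnit_half_mul_iff (hu : 2 * u = 1) (m : ℕ) :
    IsUnit (u * (2 * (m : ℤ_[p]) + 1)) ↔ ¬ p ∣ 2 * m + 1 := by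
  rw [IsUnit.mul_iff, ← isUnit_natCast_iff_not_dvd]
  push_cast
  exact and_iff_right (isUnit_half hu)

theorem step_of_isUnit (hp2 : p ≠ 2) (hu : 2 * u = 1)
    (hF : ∀ n : ℕ, ((n : ℤ_[p]) + 2) ^ 2 * F (n + 2) = ((n : ℤ_[p]) + 1) ^ 2 * F n)
    {m : ℕ} {c d : ℤ_[p]} (h1 : ¬ p ∣ m + 1) (h2 : ¬ p ∣ 2 * m + 1)
    (h : c * F (2 * m) = d * gammaProd u (2 * m : ℕ)) :
    c * F (2 * (m + 1)) = d * gammaProd u (2 * (m + 1) : ℕ) := by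
  have hG := gammaProd_two_mul_succ hp2 hu m
  have hm : IsUnit ((m : ℤ_[p]) + 1) := by exact_mod_cast (isUnit_natCast_iff_not_dvd _).2 h1
  have e1 : unitOrOne ((m : ℤ_[p]) + 1) = m + 1 := if_pos hm
  have e2 : unitOrOne (u * (2 * (m : ℤ_[p]) + 1)) = u * (2 * (m : ℤ_[p]) + 1) :=
    if_pos ((isUnit_half_mul_iff hu m).2 h2)
  rw [e1, e2] at hG
  refine (hm.pow 2).mul_left_cancel ?_
  linear_combination c * succ_sq_mul_of_recurrence hu hF m - d * hG +
    (u * (2 * m + 1)) ^ 2 * h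

omit [Fact p.Prime] in
theorem not_dvd_of_eq_add {a b c : ℕ} (h : a = p * b + c) (h0 : c ≠ 0) (hc : c < p) : ¬ p ∣ a := by
  rw [h, Nat.dvd_add_right (Dvd.intro _ rfl)]
  exact fun h' => h0 (Nat.eq_zero_of_dvd_of_lt h' hc)

/-- From 2m to 2(m+1) both sides gain ((2m+1)/(2m+2))², except where p divides 2m+1 or m+1. Over one
block of p steps, these two exceptional factors leave ((2w+1)/(2w+2))² on the left, which is exactly
F(2(w+1))/F(2w). -/
theorem gammaProd_block (hp2 : p ≠ 2) (hu : 2 * u = 1)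
    (hF : ∀ n : ℕ, ((n : ℤ_[p]) + 2) ^ 2 * F (n + 2) = ((n : ℤ_[p]) + 1) ^ 2 * F n)
    {q : ℕ} (hq : p = 2 * q + 1) (w : ℕ) : ∀ v ≤ q,
    F (2 * (p * w + v)) = F (2 * w) * gammaProd u (2 * (p * w + v) : ℕ) := by
  have hp : p.Prime := Fact.out
  have hpq : (p : ℤ_[p]) = 2 * q + 1 := by exact_mod_cast congrArg (Nat.cast : ℕ → ℤ_[p]) hq
  have hp3 := hp.two_le
  induction w with
  | zero =>
    have hbase : F (2 * (p * 0 + 0)) = F (2 * 0) * gammaProd u (2 * (p * 0 + 0) : ℕ) := by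
      simp [gammaProd_zero hp2 hu]
    intro v
    induction v with
    | zero => exact fun _ => hbase
    | succ v ih =>
      intro hv
      have := step_of_isUnit hp2 hu hF (m := p * 0 + v) (c := 1)
        (not_dvd_of_eq_add (b := 0) (c := v + 1) (by ring) (by omega) (by omega))
        (not_dvd_of_eq_add (b := 0) (c := 2 * v + 1) (by ring) (by omega) (by omega))
        (by rw [one_mul]; exact ih (by omega))
      rwa [one_mul] at this
  | succ w ihw =>
    -- Past m = pw+q, where 2m+1 = p(2w+1), F has gained (p(2w+1)/2)² while `gammaProd` has gained
    -- no such factor; the 4 clears u².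
    have hmid : ∀ v, q + 1 + v < p →
        4 * F (2 * (p * w + (q + 1 + v))) =
          (p : ℤ_[p]) ^ 2 * (2 * w + 1) ^ 2 * F (2 * w) *
            gammaProd u (2 * (p * w + (q + 1 + v)) : ℕ) := by
      intro v
      induction v with
      | zero =>
        intro _
        have hm1 : ¬ p ∣ p * w + q + 1 :=
          not_dvd_of_eq_add (b := w) (c := q + 1) (by ring) (by omega) (by omega)
        have hm : IsUnit (((p * w + q : ℕ) : ℤ_[p]) + 1) := by
          exact_mod_cast (isUnit_natCast_iff_not_dvd _).2 hm1
        have h2 : p ∣ 2 * (p * w + q) + 1 := ⟨2 * w + 1, by rw [hq]; ring⟩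
        have hG := gammaProd_two_mul_succ hp2 hu (p * w + q)
        have e1 : unitOrOne (((p * w + q : ℕ) : ℤ_[p]) + 1) = (p * w + q : ℕ) + 1 := if_pos hm
        have e2 : unitOrOne (u * (2 * ((p * w + q : ℕ) : ℤ_[p]) + 1)) = 1 :=
          if_neg fun h' => (isUnit_half_mul_iff hu _).1 h' h2
        have e3 : 2 * ((p * w + q : ℕ) : ℤ_[p]) + 1 = p * (2 * w + 1) := by
          push_cast
          linear_combination -hpq
        rw [e1, e2] at hG
        have hF' := succ_sq_mul_of_recurrence hu hF (p * w + q)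
        rw [e3, ihw q le_rfl] at hF'
        refine (hm.pow 2).mul_left_cancel ?_
        rw [show p * w + (q + 1 + 0) = p * w + q + 1 by ring]
        linear_combination 4 * hF' - (p : ℤ_[p]) ^ 2 * (2 * w + 1) ^ 2 * F (2 * w) * hG +
          (p : ℤ_[p]) ^ 2 * (2 * w + 1) ^ 2 * F (2 * w) * gammaProd u (2 * (p * w + q) : ℕ) *
            (2 * u + 1) * hu
      | succ v ih =>
        intro hv
        exact step_of_isUnit hp2 hu hF (m := p * w + (q + 1 + v))
          (not_dvd_of_eq_add (b := w) (c := q + 1 + v + 1) (by ring) (by omega) (by omega))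
          (not_dvd_of_eq_add (b := 2 * w + 1) (c := 2 * (v + 1))
            (by rw [hq]; ring) (by omega) (by omega)) (ih (by omega))
    -- Past m+1 = p(w+1) the factor p² cancels, and the recurrence at w absorbs the rest.
    have hbase : F (2 * (p * (w + 1))) = F (2 * (w + 1)) * gammaProd u (2 * (p * (w + 1)) : ℕ) := by
      obtain ⟨m, hm⟩ : ∃ m, p * (w + 1) = m + 1 :=
        Nat.exists_eq_succ_of_ne_zero (Nat.mul_ne_zero hp.ne_zero w.succ_ne_zero)
      have hmq : p * w + (q + 1 + (q - 1)) = m := by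
        have : p * (w + 1) = p * w + p := by ring
        omega
      have h1 := hmid (q - 1) (by omega)
      rw [hmq] at h1
      have hm' : (m : ℤ_[p]) + 1 = p * (w + 1) := by
        exact_mod_cast congrArg (Nat.cast : ℕ → ℤ_[p]) hm.symm
      have hG := gammaProd_two_mul_succ hp2 hu m
      have e1 : unitOrOne ((m : ℤ_[p]) + 1) = 1 := if_neg fun h' => by
        rw [isUnit_iff_not_dvd] at h'
        exact h' (hm' ▸ Dvd.intro _ rfl)
      have e2 : unitOrOne (u * (2 * (m : ℤ_[p]) + 1)) = u * (2 * (m : ℤ_[p]) + 1) := by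
        refine if_pos ((isUnit_half_mul_iff hu m).2 ?_)
        exact not_dvd_of_eq_add (b := 2 * w + 1) (c := 2 * q) (by
          have : p * (2 * w + 1) = 2 * (p * w) + p := by ring
          omega) (by omega) (by omega)
      rw [e1, e2, one_pow, one_mul] at hG
      have hF1 := succ_sq_mul_of_recurrence hu hF m
      have hF2 := succ_sq_mul_of_recurrence hu hF w
      rw [hm'] at hF1
      have hne : 4 * ((p : ℤ_[p]) * (w + 1)) ^ 2 ≠ 0 := by
        have : ((4 * (p * (w + 1)) ^ 2 : ℕ) : ℤ_[p]) ≠ 0 :=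
          Nat.cast_ne_zero.2 (by have := hp.pos; positivity)
        exact_mod_cast this
      rw [hm]
      refine mul_left_cancel₀ hne ?_
      linear_combination 4 * hF1 + (u * (2 * m + 1)) ^ 2 * h1 -
        (p : ℤ_[p]) ^ 2 * (2 * w + 1) ^ 2 * F (2 * w) * hG -
        4 * (p : ℤ_[p]) ^ 2 * gammaProd u (2 * (m + 1) : ℕ) * hF2 -
        (p : ℤ_[p]) ^ 2 * (2 * w + 1) ^ 2 * F (2 * w) * gammaProd u (2 * (m + 1) : ℕ) *
          (2 * u + 1) * hu
    intro v
    induction v with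
    | zero => exact fun _ => hbase
    | succ v ih =>
      intro hv
      have := step_of_isUnit hp2 hu hF (m := p * (w + 1) + v) (c := 1)
        (not_dvd_of_eq_add (b := w + 1) (c := v + 1) (by ring) (by omega) (by omega))
        (not_dvd_of_eq_add (b := 2 * (w + 1)) (c := 2 * v + 1) (by ring) (by omega) (by omega))
        (by rw [one_mul]; exact ih (by omega))
      rwa [one_mul] at this

end

/-! ### Digit expansion and interpolation. -/

section

variable {p : ℕ} [Fact p.Prime]

theorem chooseSum_recurrence_self {h : ℤ_[p]} (hh : 2 * h = -1) (n : ℕ) :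
    ((n : ℤ_[p]) + 2) ^ 2 * chooseSum h (n + 2 + 1) ((n + 2 : ℕ) : ℤ_[p]) =
      ((n : ℤ_[p]) + 1) ^ 2 * chooseSum h (n + 1) (n : ℤ_[p]) := by
  rw [chooseSum_recurrence hh (by omega : n + 2 < n + 2 + 1), chooseSum_eq_of_lt h (by omega)]

/-- The digit-by-digit factorization of the terminating series. -/
theorem chooseSum_digit (hp2 : p ≠ 2) {u : ℤ_[p]} (hu : 2 * u = 1) {s n : ℕ} (hs : Even s)
    (hsp : s < p) (hn : Even n) {N M : ℕ} (hN : s + p * n < N) (hM : n < M) :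
    chooseSum (-u) N ((s + p * n : ℕ) : ℤ_[p]) =
      chooseSum (-u) M (n : ℤ_[p]) * gammaProd u ((s + p * n : ℕ) : ℤ_[p]) := by
  obtain ⟨q, hq⟩ := (Fact.out : p.Prime).odd_of_ne_two hp2
  obtain ⟨v, rfl⟩ := hs
  obtain ⟨w, rfl⟩ := hn
  have h := gammaProd_block (F := fun n => chooseSum (-u) (n + 1) (n : ℤ_[p])) hp2 hu
    (chooseSum_recurrence_self (by rw [mul_neg, hu])) hq w v (by omega)
  rw [chooseSum_eq_of_lt _ hN, chooseSum_eq_of_lt _ hM]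
  simpa only [show 2 * (p * w + v) = v + v + p * (w + w) by ring, two_mul w] using h

/-- Makes the interpolation node at y = -1 a natural number, so that the digit factorization applies
there too. -/
theorem chooseSum_sub_pow (h : ℤ_[p]) (N : ℕ) {n r : ℕ} (hn : n < p ^ r) :
    chooseSum h N ((n : ℤ_[p]) - (p : ℤ_[p]) ^ r) =
      chooseSum h N ((p ^ r - 1 - n : ℕ) : ℤ_[p]) := by
  rw [← chooseSum_neg_one_sub, Nat.cast_sub (by omega), Nat.cast_sub (by omega)]
  push_cast
  congr 1
  ring

theorem gammaProd_sub_prime (u : ℤ_[p]) {s : ℕ} (hs : s < p) :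
    gammaProd u ((p - 1 - s : ℕ) : ℤ_[p]) = gammaProd u ((s : ℤ_[p]) - p) := by
  rw [← gammaProd_neg_one_sub, Nat.cast_sub (by omega), Nat.cast_sub (by omega)]
  push_cast
  congr 1
  ring

theorem even_prime_pow_sub (hp2 : p ≠ 2) {n : ℕ} (r : ℕ) (hn : Even n) :
    Even (p ^ r - 1 - n) := by
  obtain ⟨q, hq⟩ := ((Fact.out : p.Prime).odd_of_ne_two hp2).pow (n := r)
  obtain ⟨m, hm⟩ := hn
  exact ⟨q - m, by omega⟩

omit [Fact p.Prime] in
theorem digits_complement {r s n : ℕ} (hs : s < p) (hn : n < p ^ r) :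
    s + p * n < p ^ (r + 1) ∧ p ^ (r + 1) - 1 - (s + p * n) = (p - 1 - s) + p * (p ^ r - 1 - n) := by
  obtain ⟨m, hm⟩ := Nat.exists_eq_add_of_lt hn
  have h : p ^ (r + 1) = p * n + p * m + p := by rw [pow_succ, hm]; ring
  have h1 : p ^ r - 1 - n = m := by omega
  rw [h1]
  omega

/-- Here n is x truncated to r+1 digits, s its top digit, w the tail of x starting at s, and z the
tail after it. Dropping a digit may exchange a and -1-a, so the induction runs over both. -/
theorem exists_digits (hp2 : p ≠ 2) {u a a' : ℤ_[p]} (hu : 2 * u = 1) {s₀ : ℕ} (hs : Even s₀)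
    (hsp : s₀ < p) (ha : a = s₀ + p * a') (ha' : a' = a ∨ a' = -1 - a) (r : ℕ) :
    ∀ x : ℤ_[p], (x = a ∨ x = -1 - a) → ∃ (n s : ℕ) (w z : ℤ_[p]),
      Even n ∧ n < p ^ (r + 1) ∧ (w = a ∨ w = -1 - a) ∧ (z = a ∨ z = -1 - a) ∧
      w = s + p * z ∧ x = n + (p : ℤ_[p]) ^ (r + 1) * z ∧
      PadicInt.toZModPow 2 (chooseSum (-u) (p ^ (r + 1)) (n : ℤ_[p])) =
        PadicInt.toZModPow 2 (gammaProd u a) ^ r *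
          PadicInt.toZModPow 2 (gammaProd u (s : ℤ_[p])) ∧
      PadicInt.toZModPow 2 (chooseSum (-u) (p ^ (r + 1)) ((n : ℤ_[p]) - (p : ℤ_[p]) ^ (r + 1))) =
        PadicInt.toZModPow 2 (gammaProd u a) ^ r *
          PadicInt.toZModPow 2 (gammaProd u ((s : ℤ_[p]) - p)) := by
  have hp : p.Prime := Fact.out
  have hone : ∀ h : ℤ_[p], chooseSum h 1 ((0 : ℕ) : ℤ_[p]) = 1 := fun h => by simp [chooseSum]
  have hdigit : ∀ x : ℤ_[p], (x = a ∨ x = -1 - a) → ∃ (s : ℕ) (z : ℤ_[p]),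
      Even s ∧ s < p ∧ (z = a ∨ z = -1 - a) ∧ x = s + p * z := by
    rintro x (rfl | rfl)
    · exact ⟨s₀, a', hs, hsp, ha', ha⟩
    · refine ⟨p - 1 - s₀, -1 - a', by simpa using even_prime_pow_sub hp2 1 hs, by omega, ?_, ?_⟩
      · rcases ha' with rfl | rfl
        · exact Or.inr rfl
        · exact Or.inl (by ring)
      · rw [Nat.cast_sub (by omega), Nat.cast_sub (by omega)]
        push_cast
        linear_combination -ha
  induction r with
  | zero =>
    intro x hx
    obtain ⟨s, z, hs', hsp', hz, hxz⟩ := hdigit x hx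
    obtain ⟨hlt, hc⟩ := digits_complement (r := 0) (n := 0) hsp' (by simp)
    refine ⟨s, s, x, z, hs', by simpa using hsp', hx, hz, hxz, by simpa using hxz, ?_, ?_⟩
    · have := chooseSum_digit hp2 hu hs' hsp' Even.zero (N := p ^ (0 + 1)) (M := 1) hlt one_pos
      rw [mul_zero, add_zero, hone, one_mul] at this
      rw [this, pow_zero, one_mul]
    · have h1 := even_prime_pow_sub hp2 1 hs'
      rw [pow_one] at h1
      have := chooseSum_digit hp2 hu h1 (by omega) Even.zero (N := p ^ (0 + 1)) (M := 1)
        (by simp only [zero_add, pow_one]; omega) one_pos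
      rw [mul_zero, add_zero, hone, one_mul, gammaProd_sub_prime u hsp'] at this
      rw [chooseSum_sub_pow _ _ (by simpa using hsp'), pow_zero, one_mul, ← this]
      simp
  | succ r ih =>
    intro x hx
    obtain ⟨s₁, x₁, hs₁, hsp₁, hx₁, hxx₁⟩ := hdigit x hx
    obtain ⟨n, s, w, z, hn, hnlt, hw, hz, hwz, hxn, h1, h2⟩ := ih x₁ hx₁
    obtain ⟨hlt, hc⟩ := digits_complement hsp₁ hnlt
    have hx' : x = ((s₁ + p * n : ℕ) : ℤ_[p]) + (p : ℤ_[p]) ^ (r + 1 + 1) * z := by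
      push_cast
      rw [hxx₁, hxn]
      ring
    have hGx : gammaProd u x = gammaProd u a := by
      rcases hx with rfl | rfl
      · rfl
      · exact gammaProd_neg_one_sub a
    -- The truncation has at least two digits here, so it agrees with x mod p².
    have hG1 : PadicInt.toZModPow 2 (gammaProd u ((s₁ + p * n : ℕ) : ℤ_[p])) =
        PadicInt.toZModPow 2 (gammaProd u a) := by
      rw [← hGx]
      refine gammaProd_congr hp2 ((toZModPow_eq_iff_dvd _ _ _).2 ⟨-((p : ℤ_[p]) ^ r * z), ?_⟩)
      rw [hx']
      ring
    refine ⟨s₁ + p * n, s, w, z, hs₁.add (hn.mul_left p), hlt, hw, hz, hwz, hx', ?_, ?_⟩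
    · rw [chooseSum_digit hp2 hu hs₁ hsp₁ hn hlt hnlt, map_mul, h1, hG1]
      ring
    · have hG2 : PadicInt.toZModPow 2
          (gammaProd u ((p ^ (r + 1 + 1) - 1 - (s₁ + p * n) : ℕ) : ℤ_[p])) =
          PadicInt.toZModPow 2 (gammaProd u a) := by
        rw [← hG1, ← gammaProd_neg_one_sub]
        refine gammaProd_congr hp2 ((toZModPow_eq_iff_dvd _ _ _).2 ⟨-((p : ℤ_[p]) ^ r), ?_⟩)
        rw [Nat.cast_sub (by omega), Nat.cast_sub (by omega)]
        push_cast
        ring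
      have h3 := even_prime_pow_sub hp2 1 hs₁
      rw [pow_one] at h3
      rw [chooseSum_sub_pow _ _ hnlt] at h2
      rw [hc] at hG2
      rw [chooseSum_sub_pow _ _ hlt, hc, chooseSum_digit hp2 hu h3 (by omega)
        (even_prime_pow_sub hp2 (r + 1) hn) (by omega) (by omega : _ < p ^ (r + 1)), map_mul, h2,
        hG2]
      ring

theorem toZModPow_chooseSum (hp2 : p ≠ 2) {u a a' : ℤ_[p]} (hu : 2 * u = 1) {s₀ : ℕ}
    (hs : Even s₀) (hsp : s₀ < p) (ha : a = s₀ + p * a') (ha' : a' = a ∨ a' = -1 - a) (r : ℕ) :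
    PadicInt.toZModPow 2 (chooseSum (-u) (p ^ (r + 1)) a) =
      PadicInt.toZModPow 2 (gammaProd u a) ^ (r + 1) := by
  obtain ⟨n, s, w, z, -, -, hw, -, hwz, hx, h1, h2⟩ :=
    exists_digits hp2 hu hs hsp ha ha' r a (Or.inl rfl)
  have e1 := (isAffineModSq_chooseSum (-u) (r + 1) (n : ℤ_[p])).eq_interpolate z
  have e2 := (isAffineModSq_gammaProd (u := u) hp2 (s : ℤ_[p])).eq_interpolate z
  have e3 : gammaProd u w = gammaProd u a := by
    rcases hw with rfl | rfl
    · rfl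
    · exact gammaProd_neg_one_sub a
  simp only [mul_zero, add_zero, ← hx, ← hwz, e3, h1, h2, mul_neg, mul_one,
    ← sub_eq_add_neg] at e1 e2
  -- F(a) = (1+z)F(n) - zF(n - p^(r+1)) ≡ G(a)^r ((1+z)G(s) - zG(s-p)) = G(a)^r G(w), and G(w) =
  -- G(a).
  linear_combination e1 - (PadicInt.toZModPow 2 (gammaProd u a)) ^ r * e2

end

/-! ### From the hypergeometric series to the sum; residues of the parameters. -/

section

theorem ascPochhammer_eval_eq {R : Type*} [CommRing R] [BinomialRing R] (x : R) (k : ℕ) :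
    (ascPochhammer R k).eval x = k.factorial * Ring.choose (x + k - 1) k := by
  rw [← Ring.multichoose_eq, ← Polynomial.ascPochhammer_smeval_eq_eval,
    ← Ring.factorial_nsmul_multichoose_eq_ascPochhammer, nsmul_eq_mul]

theorem ascPochhammer_eval_neg_mul_neg {R : Type*} [CommRing R] [BinomialRing R] (x y : R) (k : ℕ) :
    (ascPochhammer R k).eval (-x) * (ascPochhammer R k).eval (-y) =
      (k.factorial * Ring.choose x k) * (k.factorial * Ring.choose y k) := by
  have h : ∀ z : R, Ring.choose (-z + k - 1) k = Int.negOnePow k • Ring.choose z k := by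
    intro z
    rw [show -z + (k : R) - 1 = -(z - k + 1) by ring, Ring.choose_neg,
      show z - k + 1 + k - 1 = z by ring]
  rw [ascPochhammer_eval_eq, ascPochhammer_eval_eq, h, h]
  rcases Int.units_eq_one_or (Int.negOnePow k) with h | h <;> simp [h]

theorem truncHypergeometric_eq_chooseSum (a : ℚ) (N : ℕ) :
    truncHypergeometric [1 / 2, -a, a + 1] [1, 1] 1 N = chooseSum (-(1 / 2) : ℚ) N a := by
  refine Finset.sum_congr rfl fun k _ => ?_
  have h1 := ascPochhammer_eval_neg_mul_neg (-(1 / 2) : ℚ) a k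
  have h2 := ascPochhammer_eval_eq (a + 1) k
  have h3 : (ascPochhammer ℚ k).eval 1 = k.factorial := ascPochhammer_eval_one ℚ k
  have hk : (k.factorial : ℚ) ≠ 0 := Nat.cast_ne_zero.2 k.factorial_ne_zero
  rw [neg_neg] at h1
  rw [show a + 1 + (k : ℚ) - 1 = a + k by ring] at h2
  simp only [List.map_cons, List.map_nil, List.prod_cons, List.prod_nil, mul_one, one_pow]
  rw [← mul_assoc, h1, h2, h3]
  field_simp

theorem map_chooseSum {R S : Type*} [CommRing R] [BinomialRing R] [CommRing S] [BinomialRing S]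
    (f : R →+* S) (h : R) (N : ℕ) (a : R) :
    f (chooseSum h N a) = chooseSum (f h) N (f a) := by
  simp only [chooseSum, map_sum, map_mul, Ring.map_choose, map_add, map_natCast]

variable {p : ℕ} [Fact p.Prime]

theorem leastResidue_eq {x z : ℤ_[p]} {s : ℕ} (hs : s < p) (h : x = s + p * z) :
    leastResidue p (x : ℚ_[p]) = s := by
  have hmem : s ∈ {r : ℕ | PadicModEq p 1 (x : ℚ_[p]) (r : ℚ_[p])} :=
    ⟨z, by rw [h]; push_cast; ring⟩
  have hle : leastResidue p (x : ℚ_[p]) ≤ s := Nat.sInf_le hmem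
  obtain ⟨y, hy⟩ : PadicModEq p 1 (x : ℚ_[p]) ((leastResidue p (x : ℚ_[p]) : ℕ) : ℚ_[p]) :=
    Nat.sInf_mem ⟨s, hmem⟩
  obtain ⟨d, hd⟩ := Nat.exists_eq_add_of_le hle
  have h1 : (p : ℤ_[p]) ∣ (d : ℕ) := by
    refine ⟨y - z, PadicInt.ext ?_⟩
    rw [h] at hy
    have hd' : (s : ℚ_[p]) = (leastResidue p (x : ℚ_[p]) : ℕ) + d := by exact_mod_cast hd
    rw [h] at hd'
    push_cast at hy hd' ⊢
    linear_combination hy - hd'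
  have h2 : p ∣ d := by
    by_contra h3
    exact (isUnit_iff_not_dvd _).1 ((isUnit_natCast_iff_not_dvd d).2 h3) h1
  have := Nat.eq_zero_of_dvd_of_lt h2 (by omega)
  omega

/-- With a = -1/d: if p ≡ 1 mod d then a = (p-1)/d + pa; if p ≡ -1 mod d then a = (p - (p+1)/d) +
p(-1-a). -/
theorem exists_residue_of_mul_eq {d : ℕ} {a : ℤ_[p]} (hd : d * a = -1)
    (hp : p % d = 1 ∨ (p + 1) % d = 0) (hd2 : 2 ≤ d) :
    ∃ (s : ℕ) (a' : ℤ_[p]), s < p ∧ a = s + p * a' ∧ (a' = a ∨ a' = -1 - a) := by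
  have hp0 : 0 < p := (Fact.out : p.Prime).pos
  rcases hp with h | h
  · have hq := Nat.div_add_mod p d
    rw [h] at hq
    refine ⟨p / d, a, Nat.div_lt_self hp0 hd2, ?_, Or.inl rfl⟩
    have hq' : (p : ℤ_[p]) = d * (p / d : ℕ) + 1 := by exact_mod_cast congrArg Nat.cast hq.symm
    rw [hq']
    linear_combination -((p / d : ℕ) : ℤ_[p]) * hd
  · have hq := Nat.div_add_mod (p + 1) d
    rw [h, add_zero] at hq
    have hq0 : 0 < (p + 1) / d := by
      rcases Nat.eq_zero_or_pos ((p + 1) / d) with h0 | h0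
      · rw [h0] at hq; omega
      · exact h0
    have hqp : (p + 1) / d ≤ p := Nat.lt_succ_iff.1 (Nat.div_lt_self (Nat.succ_pos p) hd2)
    refine ⟨p - (p + 1) / d, -1 - a, by omega, ?_, Or.inr rfl⟩
    have hq' : (p : ℤ_[p]) + 1 = d * ((p + 1) / d : ℕ) := by
      exact_mod_cast congrArg Nat.cast hq.symm
    rw [Nat.cast_sub hqp]
    linear_combination a * hq' + (((p + 1) / d : ℕ) : ℤ_[p]) * hd

/-- The moduli 2, 3, 4, 6 are those whose only units are ±1, which is what restricts a. -/
theorem prime_mod_eq {d : ℕ} (hp : 5 ≤ p) (hd : d ∈ ({2, 3, 4, 6} : Finset ℕ)) :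
    p.Coprime d ∧ (p % d = 1 ∨ (p + 1) % d = 0) := by
  have hpp : p.Prime := Fact.out
  have h2 : p.Coprime 2 := (Nat.coprime_primes hpp Nat.prime_two).2 (by omega)
  have h3 : p.Coprime 3 := (Nat.coprime_primes hpp Nat.prime_three).2 (by omega)
  have e2 : p % 2 ≠ 0 := fun h => by
    have := Nat.Coprime.eq_one_of_dvd h2.symm (Nat.dvd_of_mod_eq_zero h); omega
  have e3 : p % 3 ≠ 0 := fun h => by
    have := Nat.Coprime.eq_one_of_dvd h3.symm (Nat.dvd_of_mod_eq_zero h); omega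
  simp only [Finset.mem_insert, Finset.mem_singleton] at hd
  rcases hd with rfl | rfl | rfl | rfl
  · exact ⟨h2, by omega⟩
  · exact ⟨h3, by omega⟩
  · exact ⟨h2.mul_right h2, by omega⟩
  · have h6 : p % 6 % 2 = p % 2 := Nat.mod_mod_of_dvd p (by norm_num)
    have h6' : p % 6 % 3 = p % 3 := Nat.mod_mod_of_dvd p (by norm_num)
    have h6'' := Nat.mod_lt p (by norm_num : 6 > 0)
    refine ⟨h2.mul_right h3, ?_⟩
    rw [Nat.add_mod]
    interval_cases p % 6 <;> simp_all

theorem exists_unit_fraction {a : ℚ} (ha : a ∈ ({-1 / 2, -1 / 3, -1 / 4, -1 / 6} : Set ℚ)) :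
    ∃ d ∈ ({2, 3, 4, 6} : Finset ℕ), (d : ℚ) * a = -1 := by
  simp only [Set.mem_insert_iff, Set.mem_singleton_iff] at ha
  rcases ha with rfl | rfl | rfl | rfl
  · exact ⟨2, by simp, by norm_num⟩
  · exact ⟨3, by simp, by norm_num⟩
  · exact ⟨4, by simp, by norm_num⟩
  · exact ⟨6, by simp, by norm_num⟩

end

theorem mainTheorem3 (p : ℕ) [Fact p.Prime] (hp : 5 ≤ p) (r : ℕ) (hr : 1 ≤ r) (a : ℚ)
    (ha : a ∈ ({-1 / 2, -1 / 3, -1 / 4, -1 / 6} : Set ℚ))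
    (heven : Even (leastResidue p (a : ℚ_[p]))) :
    PadicModEq p 2
      ((truncHypergeometric [1 / 2, -a, a + 1] [1, 1] 1 (p ^ r) : ℚ) : ℚ_[p])
      ((-1) ^ (r * (p + 1) / 2) * padicGamma p ((-a / 2 : ℚ) : ℚ_[p]) ^ (2 * r)
        * padicGamma p (((a + 1) / 2 : ℚ) : ℚ_[p]) ^ (2 * r)) := by
  have hp2 : p ≠ 2 := by omega
  obtain ⟨d, hd, hda⟩ := exists_unit_fraction ha
  obtain ⟨hcop, hmod⟩ := prime_mod_eq hp hd
  have hd2 : 2 ≤ d := by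
    simp only [Finset.mem_insert, Finset.mem_singleton] at hd
    omega
  obtain ⟨v, hv⟩ := ((isUnit_natCast_iff (p := p) d).2 hcop.symm).exists_right_inv
  obtain ⟨u, hu⟩ := ((isUnit_natCast_iff (p := p) 2).2
    (prime_mod_eq hp (d := 2) (by simp)).1.symm).exists_right_inv
  push_cast at hu
  have hA : (d : ℤ_[p]) * -v = -1 := by rw [mul_neg, hv]
  obtain ⟨s, A', hs, hAs, hA'⟩ := exists_residue_of_mul_eq hA hmod hd2
  have hd0 : (d : ℚ_[p]) ≠ 0 := Nat.cast_ne_zero.2 (by omega)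
  have hcA : ((-v : ℤ_[p]) : ℚ_[p]) = (a : ℚ_[p]) := by
    refine mul_left_cancel₀ hd0 ?_
    have h1 : (d : ℚ_[p]) * (a : ℚ_[p]) = -1 := by
      exact_mod_cast congrArg (Rat.cast : ℚ → ℚ_[p]) hda
    have h2 := congrArg (fun x : ℤ_[p] => (x : ℚ_[p])) hA
    push_cast at h2 ⊢
    rw [h1, h2]
  have hcu : (u : ℚ_[p]) = 1 / 2 := by
    have h2 := congrArg (fun x : ℤ_[p] => (x : ℚ_[p])) hu
    push_cast at h2
    rw [eq_div_iff two_ne_zero, mul_comm]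
    exact h2
  generalize -v = A at hA hAs hA' hcA
  rw [← hcA, leastResidue_eq hs hAs] at heven
  obtain ⟨r, rfl⟩ := Nat.exists_eq_add_of_le' hr
  have key := toZModPow_chooseSum hp2 hu heven hs hAs hA' r
  rw [← map_pow, toZModPow_eq_iff_dvd] at key
  obtain ⟨z, hz⟩ := key
  refine ⟨z, ?_⟩
  have e1 : ((truncHypergeometric [1 / 2, -a, a + 1] [1, 1] 1 (p ^ (r + 1)) : ℚ) : ℚ_[p]) =
      (chooseSum (-u) (p ^ (r + 1)) A : ℤ_[p]) := by
    have h1 := map_chooseSum (Rat.castHom ℚ_[p]) (-(1 / 2)) (p ^ (r + 1)) a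
    have h2 : ((chooseSum (-u) (p ^ (r + 1)) A : ℤ_[p]) : ℚ_[p]) =
        chooseSum ((-u : ℤ_[p]) : ℚ_[p]) (p ^ (r + 1)) (A : ℚ_[p]) :=
      map_chooseSum (PadicInt.Coe.ringHom (p := p)) (-u) (p ^ (r + 1)) A
    simp only [Rat.coe_castHom] at h1
    rw [truncHypergeometric_eq_chooseSum, h1, h2, hcA]
    push_cast
    rw [hcu]
  have e2 : padicGamma p ((-a / 2 : ℚ) : ℚ_[p]) = (gammaInt (-(u * A)) : ℤ_[p]) := by
    rw [coe_gammaInt hp2]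
    congr 1
    push_cast
    rw [hcu, hcA]
    ring
  have e3 : padicGamma p (((a + 1) / 2 : ℚ) : ℚ_[p]) = (gammaInt (u * (1 + A)) : ℤ_[p]) := by
    rw [coe_gammaInt hp2]
    congr 1
    push_cast
    rw [hcu, hcA]
    ring
  -- The truncating division is harmless because p+1 is even.
  have e4 : (r + 1) * (p + 1) / 2 = (p + 1) / 2 * (r + 1) := by
    obtain ⟨q, hq⟩ := (Fact.out : p.Prime).odd_of_ne_two hp2
    rw [show (p + 1) / 2 = q + 1 by omega, show p + 1 = 2 * (q + 1) by omega,
      show (r + 1) * (2 * (q + 1)) = 2 * ((q + 1) * (r + 1)) by ring]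
    omega
  have h2 := congrArg (fun x : ℤ_[p] => (x : ℚ_[p])) hz
  rw [e1, e2, e3, e4, pow_mul, pow_mul, pow_mul]
  simp only [gammaProd] at h2
  push_cast at h2 ⊢
  rw [← h2]
  simp only [mul_pow]
  ring
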